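/- Let $(M,g)$ be a smooth Riemannian manifold (without boundary) of dimension $n\ge 0$, and let $\nabla$ be a smooth affine connection on $M$ (a covariant derivative on $TM$) which is metric, $\nabla g=0$, and whose torsion $T(X,Y)=\nabla_XY-\nabla_YX-[X,Y]$ is totally skew-symmetric, i.e. $T(X,Y,Z)=g(T(X,Y),Z)$ is a 3-form. Let $$R(X,Y)Z=\nabla_X\nabla_YZ-\nabla_Y\nabla_XZ-\nabla_{[X,Y]}Z,\qquad R(X,Y,Z,V)=g(R(X,Y)Z,V)$$ be the curvature of $\nabla$. Then $$R(X,Y,Z,V)=R(Z,Y,X,V)\quad\text{for all smooth vector fields }X,Y,Z,V$$ if and only if $\nabla$ is flat, that is, $R(X,Y)Z=0$ for all smooth vector fields $X,Y,Z$. -/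

import Mathlib

open scoped Manifold ContDiff Bundle

noncomputable section

namespace SkewTorsion

variable {n : ℕ} {M : Type*} [TopologicalSpace M]
  [ChartedSpace (EuclideanSpace ℝ (Fin n)) M] [IsManifold (𝓡 n) ∞ M]

/-- A (not necessarily smooth) vector field on the `n`-dimensional manifold `M`. -/
abbrev VectorFieldOn (n : ℕ) (M : Type*) [TopologicalSpace M]
    [ChartedSpace (EuclideanSpace ℝ (Fin n)) M] : Type _ :=
  (x : M) → TangentSpace (𝓡 n) x

/-- The vector field `X` is of class `C^∞`. -/
def IsSmoothField (X : VectorFieldOn n M) : Prop :=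
  ContMDiff (𝓡 n) (𝓡 n).tangent ∞
    (fun x : M => (⟨x, X x⟩ : TangentBundle (𝓡 n) M))

/-- Affine connections on `M`, i.e. covariant derivatives on its tangent bundle. In the
underlying function the arguments are swapped: `cov Y x (X x)` is `(∇_X Y)(x)`. -/
abbrev AffineConnection (n : ℕ) (M : Type*) [TopologicalSpace M]
    [ChartedSpace (EuclideanSpace ℝ (Fin n)) M] [IsManifold (𝓡 n) ∞ M] : Type _ :=
  CovariantDerivative (𝓡 n) (EuclideanSpace ℝ (Fin n)) (TangentSpace (𝓡 n) : M → Type _)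

/-- The vector field `∇_X Y`. -/
def nabla (cov : AffineConnection n M) (X Y : VectorFieldOn n M) : VectorFieldOn n M :=
  fun x => cov Y x (X x)

/-- The curvature `R(X,Y)Z = ∇_X ∇_Y Z - ∇_Y ∇_X Z - ∇_{[X,Y]} Z`. -/
def curvature (cov : AffineConnection n M) (X Y Z : VectorFieldOn n M) : VectorFieldOn n M :=
  nabla cov X (nabla cov Y Z) - nabla cov Y (nabla cov X Z)
    - nabla cov (VectorField.mlieBracket (𝓡 n) X Y) Z

/-- The connection is flat: `R(X,Y)Z = 0` for all smooth vector fields `X, Y, Z`. -/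
def IsFlat (cov : AffineConnection n M) : Prop :=
  ∀ X Y Z : VectorFieldOn n M, IsSmoothField X → IsSmoothField Y → IsSmoothField Z →
    curvature cov X Y Z = 0

section Metric

variable [Bundle.RiemannianBundle (fun x : M => TangentSpace (𝓡 n) x)]

/-- A smooth Riemannian metric is in particular `C^1`; recorded as an instance because the
general search is slow. -/
instance isContMDiffRiemannianBundle_one
    [IsContMDiffRiemannianBundle (𝓡 n) ∞ (EuclideanSpace ℝ (Fin n))
      (fun x : M => TangentSpace (𝓡 n) x)] :
    IsContMDiffRiemannianBundle (𝓡 n) 1 (EuclideanSpace ℝ (Fin n))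
      (fun x : M => TangentSpace (𝓡 n) x) :=
  IsContMDiffRiemannianBundle.of_le (n := ∞) (by exact_mod_cast le_top)

/-- The curvature with all arguments lowered, `R(X,Y,Z,V) = g(R(X,Y)Z, V)`. -/
def curvatureForm (cov : AffineConnection n M) (X Y Z V : VectorFieldOn n M) (x : M) : ℝ :=
  inner ℝ (curvature cov X Y Z x) (V x)

/-- The torsion with all arguments lowered, `T(u,v,w) = g(T(u,v), w)`, where
`T(X,Y) = ∇_X Y - ∇_Y X - [X,Y]`. -/
def torsionForm (cov : AffineConnection n M) (x : M) (u v w : TangentSpace (𝓡 n) x) : ℝ :=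
  inner ℝ (cov.torsion x u v) w

/-- The torsion is totally skew-symmetric, i.e. a 3-form: it changes sign under the two
transpositions of neighbouring arguments, hence under every transposition. -/
def HasSkewTorsion (cov : AffineConnection n M) : Prop :=
  ∀ (x : M) (u v w : TangentSpace (𝓡 n) x),
    torsionForm cov x u v w = -torsionForm cov x v u w ∧
    torsionForm cov x u v w = -torsionForm cov x u w v

/-- The curvature identity `R(X,Y,Z,V) = R(Z,Y,X,V)` for all smooth vector fields. -/
def SwapsFirstAndThird (cov : AffineConnection n M) : Prop :=
  ∀ X Y Z V : VectorFieldOn n M,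
    IsSmoothField X → IsSmoothField Y → IsSmoothField Z → IsSmoothField V →
    ∀ x : M, curvatureForm cov X Y Z V x = curvatureForm cov Z Y X V x

end Metric

end SkewTorsion

end

/-! Fix `V` and let S₃ permute the first three arguments of R(X,Y,Z,V). The transposition (12) acts
by -1 (`curvature_swap`), while the assumed identity makes (13) act by +1. Transpositions are
conjugate in S₃, so both signs must agree, which forces R = 0. The converse is immediate. -/

namespace SkewTorsion

section Extension

variable {n : ℕ} {M : Type*} [TopologicalSpace M] [T2Space M]
  [ChartedSpace (EuclideanSpace ℝ (Fin n)) M] [IsManifold (𝓡 n) ∞ M]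

/-- Every tangent vector is the value of a global smooth vector field. -/
theorem exists_isSmoothField_apply_eq {x : M} (v : TangentSpace (𝓡 n) x) :
    ∃ V : VectorFieldOn n M, IsSmoothField V ∧ V x = v := by
  obtain ⟨s, hs, hsmooth⟩ := FiberBundle.exists_contMDiffOn_extend (k := ∞) (𝓡 n)
    (EuclideanSpace ℝ (Fin n)) (V := (TangentSpace (𝓡 n) : M → Type _)) v
  -- Cut off a local smooth extension by a bump function equal to 1 at `x`, supported where that
  -- extension is smooth.
  obtain ⟨f, -, hf⟩ :=
    (SmoothBumpFunction.nhds_basis_tsupport (I := 𝓡 n) x).mem_iff.1 (interior_mem_nhds.2 hs)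
  refine ⟨(f : M → ℝ) • FiberBundle.extend (EuclideanSpace ℝ (Fin n)) v, ?_, ?_⟩
  · exact ContMDiffOn.smul_section_of_tsupport f.contMDiff.contMDiffOn isOpen_interior hf
      (hsmooth.mono interior_subset)
  · simp

end Extension

variable {n : ℕ} {M : Type*} [TopologicalSpace M]
  [ChartedSpace (EuclideanSpace ℝ (Fin n)) M] [IsManifold (𝓡 n) ∞ M]

/-- The curvature is skew-symmetric in its first two arguments. -/
theorem curvature_swap (cov : AffineConnection n M) (X Y Z : VectorFieldOn n M) :
    curvature cov X Y Z = -curvature cov Y X Z := by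
  funext x
  simp only [curvature, nabla, Pi.sub_apply, Pi.neg_apply]
  rw [VectorField.mlieBracket_swap_apply (V := X) (W := Y), map_neg]
  abel

end SkewTorsion

theorem theorem1p3 {n : ℕ} {M : Type*} [TopologicalSpace M] [T2Space M]
    [ChartedSpace (EuclideanSpace ℝ (Fin n)) M] [IsManifold (𝓡 n) ∞ M]
    [Bundle.RiemannianBundle (fun x : M => TangentSpace (𝓡 n) x)]
    [IsContMDiffRiemannianBundle (𝓡 n) ∞ (EuclideanSpace ℝ (Fin n))
      (fun x : M => TangentSpace (𝓡 n) x)]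
    (cov : SkewTorsion.AffineConnection n M)
    (hsmooth : cov.ContMDiffCovariantDerivative ∞)
    (hmetric : cov.IsMetricCompatible)
    (hskew : SkewTorsion.HasSkewTorsion cov) :
    SkewTorsion.SwapsFirstAndThird cov ↔ SkewTorsion.IsFlat cov := by
  have hanti (X Y Z V : SkewTorsion.VectorFieldOn n M) (x : M) :
      SkewTorsion.curvatureForm cov X Y Z V x = -SkewTorsion.curvatureForm cov Y X Z V x := by
    simp only [SkewTorsion.curvatureForm]
    rw [SkewTorsion.curvature_swap cov X Y Z, Pi.neg_apply, inner_neg_left]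
  constructor
  · intro h X Y Z hX hY hZ
    funext x
    -- Only the value at `x` matters: with this `V` the form becomes |R(X,Y)Z|² at `x`.
    obtain ⟨V, hV, hVx⟩ :=
      SkewTorsion.exists_isSmoothField_apply_eq (SkewTorsion.curvature cov X Y Z x)
    have hzero : SkewTorsion.curvatureForm cov X Y Z V x = 0 := by
      -- Alternating the two symmetries, with `V` fixed: XYZ = ZYX = -YZX = -XZY = ZXY = YXZ = -XYZ.
      linarith [h X Y Z V hX hY hZ hV x, hanti Z Y X V x, h Y Z X V hY hZ hX hV x,
        hanti X Z Y V x, h X Z Y V hX hZ hY hV x, h Z X Y V hZ hX hY hV x, hanti Y X Z V x]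
    rw [SkewTorsion.curvatureForm, hVx] at hzero
    exact inner_self_eq_zero.1 hzero
  · intro h X Y Z V hX hY hZ _ x
    simp only [SkewTorsion.curvatureForm, h X Y Z hX hY hZ, h Z Y X hZ hY hX]
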